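/- All graphs and multigraphs are finite. A multigraph may have loops and multiple edges; a loop contributes $2$ to the degree of its vertex. A *trail* in a multigraph is a sequence $v_0,e_1,v_1,\dots,e_m,v_m$ in which $e_i$ is an edge with ends $v_{i-1},v_i$ and no edge is repeated; its length is $m$, and it *spans* $L$ if it contains every vertex of $L$. Let $t(L)$ be the length of a longest trail in $L$. A multigraph $L$ is *admissible* if (A-1) $t(L)<|E(L)|$, and (A-2) for every vertex $v$ and every edge $e$ incident with $v$ there is a trail of length $t(L)$ beginning $v,e,\dots$ which spans $L$. It is *cubic* if every vertex has degree $3$. A simple graph $G$ with a distinguished set $D$ of three vertices is an *I-type graph* if (I-1) $G$ has no spanning path with both endvertices in $D$, and (I-2) for every vertex $v$ of $G$ there are a labelling $D=\{a,b,c\}$, a path $P$ (possibly with one vertex) from $v$ to $a$, and a path $Q$ from $b$ to $c$, disjoint from $P$, such that $P$ and $Q$ together contain all vertices of $G$. *Inflating* the vertices $v_1,\dots,v_k$ of a cubic multigraph $L$ with I-type graphs $G_1,\dots,G_k$ with distinguished sets $D_1,\dots,D_k$ means: replace each $v_i$ by a copy of $G_i$, and attach the three edge-ends at $v_i$ bijectively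 (in any way) to the three vertices of $D_i$, so that every edge of $L$ joining $v_i$ and $v_j$ becomes an edge joining a vertex of $D_i$ and a vertex of $D_j$. The *detour order* $\tau(F)$ of a graph $F$ is the number of vertices of a longest path in $F$, and the detour order of a vertex $v$ is the maximum number of vertices of a path starting at $v$. A simple graph is a *CND graph* if it is connected, has no hamiltonian path, and all its vertices have the same detour order. **Theorem.** Let $L$ be a cubic admissible multigraph of order $k$, and let $F$ be obtained by inflating $L$ with I-type graphs $G_i$, $i=1,\dots,k$. Then $F$ is a (simple) CND graph with detour order $$\tau(F)=2-k+\sum_{i=1}^k|V(G_i)|.$$ -/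

import Mathlib

open scoped Graph

namespace Detour

/-! ### Paths and detours in simple graphs -/

section Simple

variable {V : Type*} (G : SimpleGraph V)

/-- The detour order `τ_G(v)`: the maximal order (number of vertices) of a path
starting at `v`. -/
noncomputable def vertexDetourOrder (v : V) : ℕ :=
  sSup {n | ∃ (u : V) (p : G.Walk v u), p.IsPath ∧ p.support.length = n}

/-- The detour order `τ(G)`: the order of a longest path. -/
noncomputable def detourOrder : ℕ :=
  sSup {n | ∃ (u v : V) (p : G.Walk u v), p.IsPath ∧ p.support.length = n}

variable {G} in
/-- A path which contains all the vertices (a hamiltonian path). -/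
def IsSpanningPath {u v : V} (p : G.Walk u v) : Prop :=
  p.IsPath ∧ ∀ x, x ∈ p.support

/-- A graph is traceable if it has a hamiltonian path. -/
def IsTraceable : Prop := ∃ (u v : V) (p : G.Walk u v), IsSpanningPath p

/-- A detour graph: the detour sequence is constant. -/
def IsDetourGraph : Prop := ∀ u v : V, vertexDetourOrder G u = vertexDetourOrder G v

/-- Connected, nontraceable, detour graphs. -/
structure IsCND : Prop where
  connected : G.Connected
  nontraceable : ¬ IsTraceable G
  detour : IsDetourGraph G

/-- `G` is an I-type graph with distinguished vertex set `D`. -/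
structure IsIType (D : Finset V) : Prop where
  card_eq : D.card = 3
  /-- No spanning path has both endvertices in `D`. -/
  no_spanning_path : ∀ a ∈ D, ∀ b ∈ D, ∀ p : G.Walk a b, ¬ IsSpanningPath p
  /-- Every vertex `v` is an endvertex of a (possibly one-vertex) path `p` whose other endvertex
  `a` is in `D`, such that the other two vertices `b, c` of `D` are joined by a path `q` disjoint
  from `p`, and `p` and `q` together span `G`. -/
  exists_paths : ∀ v : V, ∃ a b c : V, (∀ d, d ∈ D ↔ d = a ∨ d = b ∨ d = c) ∧
    ∃ (p : G.Walk v a) (q : G.Walk b c), p.IsPath ∧ q.IsPath ∧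
      p.support.Disjoint q.support ∧ ∀ x, x ∈ p.support ∨ x ∈ q.support

end Simple

/-! ### Trails in multigraphs (loops and multiple edges allowed) -/

section Multi

variable {α β : Type*} (L : Graph α β)

/-- `IsWalkFrom L v₀ [(e₁, v₁), …, (eₖ, vₖ)]` says that `v₀, e₁, v₁, …, eₖ, vₖ` is a walk in `L`,
i.e. the ends of `eᵢ` are `vᵢ₋₁` and `vᵢ`. -/
inductive IsWalkFrom : α → List (β × α) → Prop
  | nil {v : α} (hv : v ∈ V(L)) : IsWalkFrom v []
  | cons {u v : α} {e : β} {w : List (β × α)} (h : L.IsLink e u v) (hw : IsWalkFrom v w) :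
      IsWalkFrom u ((e, v) :: w)

/-- A trail is a walk in which no edge is repeated. -/
def IsTrailFrom (v : α) (w : List (β × α)) : Prop :=
  IsWalkFrom L v w ∧ (w.map Prod.fst).Nodup

/-- `t(L)`, the length (number of edges) of a longest trail in `L`. -/
noncomputable def maxTrailLength : ℕ :=
  sSup {n | ∃ (v : α) (w : List (β × α)), IsTrailFrom L v w ∧ w.length = n}

/-- Admissible multigraphs. -/
structure IsAdmissible : Prop where
  maxTrailLength_lt : maxTrailLength L < E(L).ncard
  /-- For each edge `e` incident with a vertex `v` there is a spanning trail `v, e, …`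
  of length `t(L)`. -/
  exists_trail : ∀ (v : α) (e : β), L.Inc e v → ∃ (x : α) (w : List (β × α)),
    IsTrailFrom L v ((e, x) :: w) ∧ ((e, x) :: w).length = maxTrailLength L ∧
      ∀ u ∈ V(L), u ∈ v :: ((e, x) :: w).map Prod.snd

/-- A multigraph is cubic if all its vertices have degree three; as usual, a loop contributes
two to the degree of its vertex. -/
def IsCubic : Prop :=
  ∀ v ∈ V(L), (L.incidenceSet v).ncard + (L.loopSet v).ncard = 3

/-! ### Inflation -/

/-- Each vertex `i` of `L` is to be replaced by a graph on `W i` with set `D i` of distinguished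
vertices. An attachment specifies to which two distinguished vertices each edge of `L` is attached
after all these replacements: an edge with ends `i`, `j` joins a distinguished vertex of
the copy at `i` to one of the copy at `j`, and the edge-ends at `i` are matched
bijectively with the elements of `D i`. -/
structure Attachment (W : V(L) → Type*) (D : ∀ i, Finset (W i)) where
  ends : E(L) → Sym2 (Σ i, W i)
  isLink : ∀ (e : E(L)) (x y : Σ i, W i), ends e = s(x, y) → L.IsLink e x.1 y.1
  mem_distinguished : ∀ (e : E(L)), ∀ x ∈ ends e, x.2 ∈ D x.1
  not_isDiag : ∀ e : E(L), ¬ (ends e).IsDiag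
  existsUnique : ∀ (i : V(L)), ∀ d ∈ D i, ∃! e : E(L), (⟨i, d⟩ : Σ i, W i) ∈ ends e

variable {L} {W : V(L) → Type*} {D : ∀ i, Finset (W i)}

/-- The edges of the copies of the graphs `G i` in the inflation. -/
def InnerAdj (G : ∀ i, SimpleGraph (W i)) (x y : Σ i, W i) : Prop :=
  ∃ (i : V(L)) (u v : W i), (G i).Adj u v ∧ x = ⟨i, u⟩ ∧ y = ⟨i, v⟩

/-- The graph obtained by inflating each vertex `i` of `L` with `G i`: the disjoint union of
the graphs `G i`, together with the edges of `L`, attached as the attachment `A` prescribes. -/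
def inflation (G : ∀ i, SimpleGraph (W i)) (A : Attachment L W D) :
    SimpleGraph (Σ i, W i) where
  Adj x y := InnerAdj G x y ∨ ∃ e, A.ends e = s(x, y)
  symm := ⟨by
    rintro x y (⟨i, u, v, h, hx, hy⟩ | ⟨e, he⟩)
    · exact Or.inl ⟨i, v, u, h.symm, hy, hx⟩
    · exact Or.inr ⟨e, he.trans Sym2.eq_swap⟩⟩
  loopless := ⟨by
    rintro x (⟨i, u, v, h, rfl, hy⟩ | ⟨e, he⟩)
    · obtain rfl : u = v := by simpa using hy
      exact h.ne rfl
    · exact A.not_isDiag e (by rw [he]; exact rfl)⟩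

/-- The inflation creates no multiple edges: distinct edges of `L` are attached to distinct pairs
of vertices, and no edge of `L` becomes parallel to an edge of some `G i`. -/
def NoMultipleEdges (G : ∀ i, SimpleGraph (W i)) (A : Attachment L W D) : Prop :=
  Function.Injective A.ends ∧ ∀ (e : E(L)) (x y : Σ i, W i), A.ends e = s(x, y) → ¬ InnerAdj G x y

end Multi

end Detour

/-! Upper bound: only three edge-ends are attached to a copy, while each visit by a path that
neither starts nor ends there uses two. So such a path visits the copy at most once, along a path
between distinguished vertices, and (I-1) makes it miss a vertex (`exists_notMem_support`). All but
at most two copies lose a vertex, so no path has more than `∑ |W i| - (k - 2)` vertices.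

Lower bound: given `v` in copy `i₀`, split that copy by (I-2) into a path from `v` to `a` and a path
between the other two distinguished vertices. Take a longest spanning trail of `L` leaving `i₀` by
the edge at `a`. It cannot be extended, so it uses all edge-ends at its first and last vertices;
counting three ends per vertex, these two vertices differ and every vertex is an inner vertex of the
trail exactly once (`Attachment.IsLift.visits`). Replace each inner visit by a path covering the
copy except one distinguished vertex. In copy `i₀` use the second path of the splitting instead; in
the last copy omit the vertex where the trail will end. These two copies are then covered completely
and every other copy up to one vertex, so the bound is attained from every `v`. By (A-1) some edge
is unused; its ends lie at neither end of the trail, so `k > 2` and the bound rules out hamiltonian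
paths. -/

namespace Detour

/-! ### I-type graphs -/

section Simple

variable {V : Type*} {G : SimpleGraph V} {D : Finset V}

/-- The first path of the decomposition (I-2), with the other one available between the remaining
two distinguished vertices in either direction. -/
theorem IsIType.exists_path_pair (h : IsIType G D) (v : V) :
    ∃ a ∈ D, ∃ p : G.Walk v a, p.IsPath ∧ ∀ b ∈ D, ∀ c ∈ D, b ≠ c → a ≠ b → a ≠ c →
      ∃ q : G.Walk b c, q.IsPath ∧ p.support.Disjoint q.support ∧
        ∀ x, x ∈ p.support ∨ x ∈ q.support := by
  obtain ⟨a, b, c, hD, p, q, hp, hq, hdisj, hspan⟩ := h.exists_paths v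
  refine ⟨a, (hD a).2 (Or.inl rfl), p, hp, fun b' hb' c' hc' hne hab hac => ?_⟩
  have hb := ((hD b').1 hb').resolve_left hab.symm
  have hc := ((hD c').1 hc').resolve_left hac.symm
  rcases hb with rfl | rfl <;> rcases hc with rfl | rfl
  · exact absurd rfl hne
  · exact ⟨q, hq, hdisj, hspan⟩
  · exact ⟨q.reverse, hq.reverse, by simpa [List.Disjoint] using hdisj, by simpa using hspan⟩
  · exact absurd rfl hne

/-- This is (I-2) at a distinguished vertex `a`, where the first path is forced to be trivial. -/
theorem IsIType.exists_path_avoiding (h : IsIType G D) {a b c : V} (ha : a ∈ D) (hb : b ∈ D)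
    (hc : c ∈ D) (hbc : b ≠ c) (hab : a ≠ b) (hac : a ≠ c) :
    ∃ q : G.Walk b c, q.IsPath ∧ a ∉ q.support ∧ ∀ x, x ≠ a → x ∈ q.support := by
  obtain ⟨a', ha', p, hp, H⟩ := h.exists_path_pair a
  -- Otherwise `a` is an end of the second path as well, against disjointness.
  obtain rfl : a = a' := by
    by_contra hne
    by_cases hba : b = a'
    · obtain ⟨q, -, hd, -⟩ := H a ha c hc hac (Ne.symm hne) (hba ▸ hbc)
      exact hd p.start_mem_support q.start_mem_support
    · obtain ⟨q, -, hd, -⟩ := H a ha b hb hab (Ne.symm hne) (Ne.symm hba)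
      exact hd p.start_mem_support q.start_mem_support
  obtain rfl := (SimpleGraph.Walk.isPath_iff_nil.1 hp).eq_nil
  obtain ⟨q, hq, hd, hs⟩ := H b hb c hc hbc hab hac
  refine ⟨q, hq, fun hx => hd (by simp) hx, fun x hx => (hs x).resolve_left (by simpa using hx)⟩

theorem IsIType.exists_third (h : IsIType G D) (a b : V) : ∃ c ∈ D, c ≠ a ∧ c ≠ b := by
  classical
  have : ({a, b} : Finset V).card < D.card := by
    rw [h.card_eq]; exact Finset.card_le_two.trans_lt (by norm_num)
  obtain ⟨c, hc, hn⟩ := Finset.exists_mem_notMem_of_card_lt_card this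
  exact ⟨c, hc, by simpa using hn⟩

/-- An edge `ab` would extend a path from `b` to `c` missing only `a` to a spanning path, against
(I-1). -/
theorem IsIType.not_adj (h : IsIType G D) {a b : V} (ha : a ∈ D) (hb : b ∈ D) : ¬ G.Adj a b := by
  intro hab
  obtain ⟨c, hc, hca, hcb⟩ := h.exists_third a b
  obtain ⟨q, hq, hn, hs⟩ := h.exists_path_avoiding ha hb hc hcb.symm hab.ne hca.symm
  refine h.no_spanning_path a ha c hc (.cons hab q)
    ⟨(SimpleGraph.Walk.cons_isPath_iff _ _).2 ⟨hq, hn⟩, fun x => ?_⟩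
  by_cases hx : x = a
  · simp [hx]
  · simp [hs x hx]

theorem IsIType.exists_mem (h : IsIType G D) : ∃ a, a ∈ D :=
  Finset.card_pos.1 (by rw [h.card_eq]; norm_num)

theorem IsIType.preconnected (h : IsIType G D) : G.Preconnected := by
  classical
  obtain ⟨a, b, c, hab, hac, hbc, rfl⟩ := Finset.card_eq_three.1 h.card_eq
  obtain ⟨q, -, -, hs⟩ := h.exists_path_avoiding (a := a) (b := b) (c := c)
    (by simp) (by simp) (by simp) hbc hab hac
  obtain ⟨q', -, -, hs'⟩ := h.exists_path_avoiding (a := b) (b := a) (c := c)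
    (by simp) (by simp) (by simp) hac hab.symm hbc
  have key : ∀ x, G.Reachable c x := fun x => by
    by_cases hx : x = a
    · exact (q'.reverse.takeUntil x (by simpa using hs' x (hx ▸ hab))).reachable
    · exact (q.reverse.takeUntil x (by simpa using hs x hx)).reachable
  exact fun x y => (key x).symm.trans (key y)

end Simple

/-! ### The inflated graph and the upper bound for its paths -/

section Inflation

variable {α β : Type*} {L : Graph α β} {W : V(L) → Type*} {D : ∀ i, Finset (W i)}

/-- The distinguished vertices `x` and `y` are joined by an edge of `L`. -/
def Attachment.Mate (A : Attachment L W D) (x y : Σ i, W i) : Prop := ∃ e, A.ends e = s(x, y)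

variable {A : Attachment L W D} {G : ∀ i, SimpleGraph (W i)} {x y z : Σ i, W i}

theorem Attachment.Mate.symm (h : A.Mate x y) : A.Mate y x :=
  h.imp fun _ he => he.trans Sym2.eq_swap

theorem Attachment.Mate.left_mem (h : A.Mate x y) : x.2 ∈ D x.1 := by
  obtain ⟨e, he⟩ := h
  exact A.mem_distinguished e x (by simp [he])

theorem Attachment.Mate.right_mem (h : A.Mate x y) : y.2 ∈ D y.1 := h.symm.left_mem

theorem Attachment.eq_of_mem_ends {e e' : E(L)} (h : x ∈ A.ends e) (h' : x ∈ A.ends e') :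
    e = e' :=
  (A.existsUnique x.1 x.2 (A.mem_distinguished e x h)).unique h h'

theorem Attachment.Mate.right_unique (h : A.Mate x y) (h' : A.Mate x z) : y = z := by
  obtain ⟨e, he⟩ := h
  obtain ⟨e', he'⟩ := h'
  obtain rfl : e = e' := A.eq_of_mem_ends (x := x) (by simp [he]) (by simp [he'])
  exact Sym2.congr_right.1 (he.symm.trans he')

theorem Attachment.Mate.adj (h : A.Mate x y) : (inflation G A).Adj x y := Or.inr h

theorem InnerAdj.fst_eq (h : InnerAdj G x y) : x.1 = y.1 := by
  obtain ⟨i, u, v, -, rfl, rfl⟩ := h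
  rfl

variable (G A) in
/-- The inclusion of the copy of `G i` in the inflation. -/
def fiberHom (i : V(L)) : G i →g inflation G A where
  toFun u := ⟨i, u⟩
  map_rel' h := Or.inl ⟨i, _, _, h, rfl, rfl⟩

/-- A distinguished vertex carries only one edge-end, and distinguished vertices of one copy are
never adjacent inside it. -/
theorem noMultipleEdges (hG : ∀ i, IsIType (G i) (D i)) : NoMultipleEdges G A := by
  refine ⟨fun e e' h => ?_, fun e x y he hi => ?_⟩
  · obtain ⟨x, hx⟩ : ∃ x, x ∈ A.ends e := ⟨_, Sym2.out_fst_mem _⟩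
    exact A.eq_of_mem_ends hx (h ▸ hx)
  · have hm : A.Mate x y := ⟨e, he⟩
    obtain ⟨i, u, v, huv, rfl, rfl⟩ := hi
    exact (hG i).not_adj hm.left_mem hm.right_mem huv

theorem length_le_three (hG : ∀ i, IsIType (G i) (D i)) (i : V(L)) {l : List (Σ i, W i)}
    (hl : l.Nodup) (h : ∀ x ∈ l, x.1 = i ∧ x.2 ∈ D x.1) : l.length ≤ 3 := by
  classical
  rw [← List.toFinset_card_of_nodup hl, ← (hG i).card_eq,
    ← Finset.card_map (Function.Embedding.sigmaMk i)]
  refine Finset.card_le_card fun x hx => ?_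
  obtain ⟨rfl, hD⟩ := h x (List.mem_toFinset.1 hx)
  exact Finset.mem_map.2 ⟨x.2, hD, rfl⟩

/-! ### Paths of the inflation leave a vertex of each copy not containing an endvertex -/

/-- A walk that starts in the copy of `G i` and ends outside stays in that copy until it takes an
edge of `L`. -/
theorem exists_exit {i : V(L)} (p : (inflation G A).Walk x y) (hy : y.1 ≠ i) (u : W i)
    (hu : x = ⟨i, u⟩) : ∃ (d : W i) (q : (G i).Walk u d) (z : Σ i, W i)
      (p' : (inflation G A).Walk z y), A.Mate ⟨i, d⟩ z ∧
        p.support = q.support.map (Sigma.mk i) ++ p'.support := by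
  induction p generalizing u with
  | nil => subst hu; exact absurd rfl hy
  | @cons x x' y h p' ih =>
    subst hu
    rcases h with ⟨j, u', v', huv, hx, rfl⟩ | hm
    · obtain ⟨rfl, hx⟩ := Sigma.mk.inj_iff.1 hx
      obtain rfl := eq_of_heq hx
      obtain ⟨d, q, z, p'', hm, hs⟩ := ih hy v' rfl
      refine ⟨d, .cons huv q, z, p'', hm, ?_⟩
      change _ :: p'.support = _
      simp [hs]
    · exact ⟨u, .nil, x', p', hm, rfl⟩

/-- A walk that starts outside the copy of `G i` and meets it enters it along an edge of `L`. -/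
theorem exists_entry {i : V(L)} (p : (inflation G A).Walk x y) (hx : x.1 ≠ i)
    (hmeet : ∃ w : W i, ⟨i, w⟩ ∈ p.support) : ∃ (l : List (Σ i, W i)) (o : Σ i, W i) (d : W i)
      (p' : (inflation G A).Walk ⟨i, d⟩ y), o ∈ l ∧ A.Mate o ⟨i, d⟩ ∧
        (∀ a ∈ l, a.1 ≠ i) ∧ p.support = l ++ p'.support := by
  induction p with
  | nil =>
    obtain ⟨w, hw⟩ := hmeet
    obtain rfl := List.mem_singleton.1 hw
    exact absurd rfl hx
  | @cons x x' y h p' ih =>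
    by_cases hx' : x'.1 = i
    · obtain ⟨j, d⟩ := x'
      obtain rfl : j = i := hx'
      have hm : A.Mate x ⟨j, d⟩ := h.resolve_left fun hi => hx hi.fst_eq
      exact ⟨[x], x, d, p', by simp, hm, by simpa using hx, by simp⟩
    · obtain ⟨w, hw⟩ := hmeet
      have hw' : ⟨i, w⟩ ∈ p'.support := by
        rcases List.mem_cons.1 hw with rfl | hw
        · exact absurd rfl hx
        · exact hw
      obtain ⟨l, o, d, p'', ho, hm, hl, hs⟩ := ih hx' ⟨w, hw'⟩
      exact ⟨x :: l, o, d, p'', by simp [ho], hm, by simpa using ⟨hx, hl⟩, by simp [hs]⟩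

theorem exists_notMem_support (hG : ∀ i, IsIType (G i) (D i)) {i : V(L)}
    {p : (inflation G A).Walk x y} (hp : p.IsPath) (hx : x.1 ≠ i) (hy : y.1 ≠ i) :
    ∃ w : W i, ⟨i, w⟩ ∉ p.support := by
  by_contra! hall
  obtain ⟨a, -⟩ := (hG i).exists_mem
  obtain ⟨l, o, d₁, p₁, ho, hm₁, hl, hs₁⟩ := exists_entry p hx ⟨a, hall a⟩
  obtain ⟨d₂, q, z, p₂, hm₂, hs₂⟩ := exists_exit p₁ hy d₁ rfl
  have hnd := hp.support_nodup
  rw [hs₁, hs₂, List.nodup_append'] at hnd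
  obtain ⟨-, hnd, hdisj⟩ := hnd
  obtain ⟨hq, hnd₂, hdisj₂⟩ := List.nodup_append'.1 hnd
  by_cases hmeet : ∃ w : W i, ⟨i, w⟩ ∈ p₂.support
  · have h₁₂ : d₁ ≠ d₂ := by
      rintro rfl
      obtain rfl := hm₁.symm.right_unique hm₂
      exact hdisj ho (by simp)
    -- If the exit edge comes from a loop of `L`, the path re-enters at once and the vertex before
    -- re-entry is `⟨i, d₂⟩` itself.
    obtain ⟨l', o', d₃, p₃, ho', hm₃, hs₃⟩ : ∃ (l : List (Σ i, W i)) (o : Σ i, W i) (d : W i)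
        (p' : (inflation G A).Walk ⟨i, d⟩ y), o ∈ ⟨i, d₂⟩ :: l ∧ A.Mate o ⟨i, d⟩ ∧
          p₂.support = l ++ p'.support := by
      by_cases hz : z.1 = i
      · obtain ⟨j, d⟩ := z
        obtain rfl : j = i := hz
        exact ⟨[], _, d, p₂, by simp, hm₂, by simp⟩
      · obtain ⟨l', o', d₃, p₃, ho', hm₃, -, hs₃⟩ := exists_entry p₂ hz hmeet
        exact ⟨l', o', d₃, p₃, by simp [ho'], hm₃, hs₃⟩
    obtain ⟨d₄, q', z', p₄, hm₄, hs₄⟩ := exists_exit p₃ hy d₃ rfl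
    rw [hs₃, hs₄] at hnd₂ hdisj₂
    obtain ⟨-, hnd₃, hdisj₃⟩ := List.nodup_append'.1 hnd₂
    have h₃₄ : d₃ ≠ d₄ := by
      rintro rfl
      obtain rfl := hm₃.symm.right_unique hm₄
      rcases List.mem_cons.1 ho' with rfl | ho'
      · exact hdisj₂ (List.mem_map_of_mem q.end_mem_support) (by simp)
      · exact hdisj₃ ho' (by simp)
    have hne : ∀ u ∈ q.support, ∀ v ∈ q'.support, u ≠ v := by
      rintro u hu _ hv rfl
      exact hdisj₂ (List.mem_map_of_mem hu) (by simp [hv])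
    have := length_le_three hG i (l := [⟨i, d₁⟩, ⟨i, d₂⟩, ⟨i, d₃⟩, ⟨i, d₄⟩])
      (by
        simp [h₁₂, h₃₄, hne d₁ (by simp) d₃ (by simp), hne d₁ (by simp) d₄ (by simp),
          hne d₂ (by simp) d₃ (by simp), hne d₂ (by simp) d₄ (by simp)])
      (by simpa using ⟨hm₁.right_mem, hm₂.left_mem, hm₃.right_mem, hm₄.left_mem⟩)
    simp at this
  · refine (hG i).no_spanning_path d₁ hm₁.right_mem d₂ hm₂.left_mem q
      ⟨SimpleGraph.Walk.IsPath.mk' hq.of_map, fun w => ?_⟩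
    have hw := hall w
    rw [hs₁, hs₂] at hw
    simp only [List.mem_append, List.mem_map] at hw
    rcases hw with hw | ⟨v, hv, hvw⟩ | hw
    · exact absurd rfl (hl _ hw)
    · rwa [← sigma_mk_injective hvw]
    · exact absurd ⟨w, hw⟩ hmeet

theorem length_support_add_card_le [Fintype V(L)] [∀ i, Fintype (W i)]
    (hG : ∀ i, IsIType (G i) (D i)) {p : (inflation G A).Walk x y} (hp : p.IsPath) :
    p.support.length + Fintype.card V(L) ≤ ∑ i, Fintype.card (W i) + 2 := by
  classical
  have H : ∀ i, i ≠ x.1 → i ≠ y.1 → ∃ w : W i, ⟨i, w⟩ ∉ p.support :=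
    fun i hx hy => exists_notMem_support hG hp hx.symm hy.symm
  have : ∀ i, Nonempty (W i) := fun i => ⟨(hG i).exists_mem.choose⟩
  choose! f hf using H
  have hcard : (p.support.toFinset ∪ (Finset.univ \ {x.1, y.1}).image
      (fun i => (⟨i, f i⟩ : Σ i, W i))).card ≤ Fintype.card (Σ i, W i) := Finset.card_le_univ _
  rw [Finset.card_union_of_disjoint, List.toFinset_card_of_nodup hp.support_nodup,
    Finset.card_image_of_injective _ (fun i j h => congrArg Sigma.fst h), Fintype.card_sigma]
    at hcard
  · have h1 := Finset.le_card_sdiff {x.1, y.1} (Finset.univ : Finset V(L))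
    have h2 : ({x.1, y.1} : Finset V(L)).card ≤ 2 := Finset.card_le_two
    rw [Finset.card_univ] at h1
    omega
  · rw [Finset.disjoint_right]
    intro z hz
    obtain ⟨i, hi, rfl⟩ := Finset.mem_image.1 hz
    simp only [Finset.mem_sdiff, Finset.mem_univ, true_and, Finset.mem_insert,
      Finset.mem_singleton, not_or] at hi
    simpa using hf i hi.1 hi.2

end Inflation

/-! ### Trails of `L` as sequences of edge-ends -/

section Lift

variable {α β : Type*} {L : Graph α β} {W : V(L) → Type*} {D : ∀ i, Finset (W i)}

/-- A trail of `L`, lifted to the edge-ends it traverses: `x` is the first one, `z` the last one,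
and `r` lists the pairs of edge-ends by which it enters and leaves its inner vertices. -/
inductive Attachment.IsLift (A : Attachment L W D) :
    (Σ i, W i) → List ((Σ i, W i) × (Σ i, W i)) → (Σ i, W i) → Prop
  | single {x z : Σ i, W i} (h : A.Mate x z) : A.IsLift x [] z
  | cons {x y x' z : Σ i, W i} {r : List ((Σ i, W i) × (Σ i, W i))} (h : A.Mate x y)
      (hy : y.1 = x'.1) (hr : A.IsLift x' r z) : A.IsLift x ((y, x') :: r) z

/-- The list of all the edge-ends of a lifted trail. -/
def edgeEnds {X : Type*} (x : X) (r : List (X × X)) (z : X) : List X :=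
  x :: (r.flatMap fun p => [p.1, p.2]) ++ [z]

variable {A : Attachment L W D} {G : ∀ i, SimpleGraph (W i)} {x z : Σ i, W i}
  {r : List ((Σ i, W i) × (Σ i, W i))}

theorem edgeEnds_cons {X : Type*} (x y x' z : X) (r : List (X × X)) :
    edgeEnds x ((y, x') :: r) z = x :: y :: edgeEnds x' r z := by
  simp [edgeEnds]

theorem mem_edgeEnds {X : Type*} {x z a : X} {r : List (X × X)} :
    a ∈ edgeEnds x r z ↔ a = x ∨ (∃ p ∈ r, a = p.1 ∨ a = p.2) ∨ a = z := by
  simp [edgeEnds]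

theorem Attachment.IsLift.mem_distinguished (h : A.IsLift x r z) :
    ∀ a ∈ edgeEnds x r z, a.2 ∈ D a.1 := by
  induction h with
  | single h => simpa [edgeEnds] using ⟨h.left_mem, h.right_mem⟩
  | cons h hy hr ih =>
    rw [edgeEnds_cons]
    simp only [List.mem_cons, forall_eq_or_imp]
    exact ⟨h.left_mem, h.right_mem, ih⟩

theorem Attachment.IsLift.fst_eq (h : A.IsLift x r z) : ∀ p ∈ r, p.1.1 = p.2.1 := by
  induction h with
  | single h => simp
  | cons h hy hr ih => simpa using ⟨hy, by simpa using ih⟩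

/-- Joining the edges of a lifted trail by walks inside the copies it passes through. -/
theorem Attachment.IsLift.exists_walk (h : A.IsLift x r z)
    (seg : (Σ i, W i) × (Σ i, W i) → List (Σ i, W i))
    (hseg : ∀ p ∈ r, ∃ q : (inflation G A).Walk p.1 p.2, q.support = seg p) :
    ∃ q : (inflation G A).Walk x z, q.support = x :: r.flatMap seg ++ [z] := by
  induction h with
  | single h => exact ⟨.cons h.adj .nil, by simp⟩
  | cons h hy hr ih =>
    obtain ⟨q, hq⟩ := hseg _ List.mem_cons_self
    obtain ⟨q', hq'⟩ := ih fun p hp => hseg p (List.mem_cons_of_mem _ hp)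
    refine ⟨.cons h.adj (q.append q'), ?_⟩
    rw [SimpleGraph.Walk.support_cons, SimpleGraph.Walk.support_append, hq, hq']
    simp

theorem exists_mem_ends {e : E(L)} {i : V(L)} {v : α} (h : L.IsLink e i v) :
    ∃ x ∈ A.ends e, x.1 = i := by
  obtain ⟨y, hy⟩ : ∃ y, y ∈ A.ends e := ⟨_, Sym2.out_fst_mem _⟩
  obtain ⟨y', hy'⟩ := Sym2.mem_iff_exists.1 hy
  rcases h.left_eq_or_eq (A.isLink e y y' hy') with h | h
  · exact ⟨y, hy, Subtype.ext h.symm⟩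
  · exact ⟨y', by simp [hy'], Subtype.ext h.symm⟩

/-- Edge-ends also record the direction in which a loop is traversed, and make the count of three
per vertex literal. The last clause is carried through the induction because walks grow at the
front, whereas maximality also needs an extension at the back. -/
theorem IsTrailFrom.exists_lift (w : List (β × α)) : ∀ {v u : α} {e : β}
    (_ : IsTrailFrom L v ((e, u) :: w)) (he : e ∈ E(L)) (x : Σ i, W i) (_ : x.1.1 = v)
    (_ : x ∈ A.ends ⟨e, he⟩),
    ∃ r z, A.IsLift x r z ∧ (edgeEnds x r z).Nodup ∧
      (∀ e' : E(L), ∀ a ∈ A.ends e',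
        (a ∈ edgeEnds x r z ↔ (e' : β) ∈ ((e, u) :: w).map Prod.fst)) ∧
      (∀ i : V(L), (i : α) ∈ v :: ((e, u) :: w).map Prod.snd → ∃ a ∈ edgeEnds x r z, a.1 = i) ∧
      ∀ e' u', L.IsLink e' z.1 u' → IsWalkFrom L v (((e, u) :: w) ++ [(e', u')]) := by
  induction w with
  | nil =>
    rintro v u e ⟨hw, -⟩ he x rfl hx
    obtain ⟨z, hz⟩ := Sym2.mem_iff_exists.1 hx
    rcases hw with _ | ⟨hl, hw⟩
    obtain rfl : u = z.1 := hl.right_unique (A.isLink _ x z hz)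
    have hne : x ≠ z := by
      rintro rfl
      exact A.not_isDiag _ (by rw [hz]; exact rfl)
    refine ⟨[], z, .single ⟨_, hz⟩, by simpa [edgeEnds] using hne, fun e' a ha => ?_, ?_, ?_⟩
    · simp only [edgeEnds, List.flatMap_nil, List.cons_append, List.nil_append, List.mem_cons,
        List.not_mem_nil, or_false, List.map_cons, List.map_nil]
      rw [← Sym2.mem_iff, ← hz]
      exact ⟨fun h => congrArg Subtype.val (A.eq_of_mem_ends ha h), fun h => by
        obtain rfl : e' = ⟨e, he⟩ := Subtype.ext h
        exact ha⟩
    · intro i hi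
      simp only [List.map_cons, List.map_nil, List.mem_cons, List.not_mem_nil, or_false] at hi
      rcases hi with hi | hi
      · exact ⟨x, by simp [edgeEnds], Subtype.ext hi.symm⟩
      · exact ⟨z, by simp [edgeEnds], Subtype.ext hi.symm⟩
    · exact fun e' u' h' => .cons hl (.cons h' (.nil h'.right_mem))
  | cons p w ih =>
    obtain ⟨e₂, u₂⟩ := p
    rintro v u e ⟨hw, hnd⟩ he x rfl hx
    obtain ⟨y, hy⟩ := Sym2.mem_iff_exists.1 hx
    rcases hw with _ | ⟨hl, hw⟩
    obtain rfl : u = y.1 := hl.right_unique (A.isLink _ x y hy)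
    have hne : x ≠ y := by
      rintro rfl
      exact A.not_isDiag _ (by rw [hy]; exact rfl)
    have hl₂ : L.IsLink e₂ y.1 u₂ := by
      rcases hw with _ | ⟨h, -⟩
      exact h
    obtain ⟨x', hx', hxy⟩ := exists_mem_ends (A := A) (e := ⟨e₂, hl₂.edge_mem⟩) hl₂
    rw [List.map_cons, List.nodup_cons] at hnd
    obtain ⟨r, z, hr, hnd', hE, hV, hext⟩ :=
      ih ⟨hw, hnd.2⟩ hl₂.edge_mem x' (congrArg Subtype.val hxy) hx'
    have hyE : y ∈ A.ends ⟨e, he⟩ := by simp [hy]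
    refine ⟨(y, x') :: r, z, .cons ⟨_, hy⟩ hxy.symm hr, ?_, fun e' a ha => ?_, fun i hi => ?_,
      fun e' u' h' => .cons hl (hext e' u' h')⟩
    · rw [edgeEnds_cons, List.nodup_cons, List.nodup_cons, List.mem_cons, hE _ x hx, hE _ y hyE]
      exact ⟨not_or.2 ⟨hne, hnd.1⟩, hnd.1, hnd'⟩
    · rw [edgeEnds_cons, List.mem_cons, List.mem_cons, hE e' a ha, ← or_assoc, ← Sym2.mem_iff,
        ← hy, List.map_cons (f := Prod.fst) (a := (e, _)), List.mem_cons]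
      refine or_congr_left ⟨fun h => congrArg Subtype.val (A.eq_of_mem_ends ha h), fun h => ?_⟩
      obtain rfl : e' = ⟨e, he⟩ := Subtype.ext h
      exact ha
    · rw [edgeEnds_cons]
      rcases List.mem_cons.1 hi with hi | hi
      · exact ⟨x, by simp, Subtype.ext hi.symm⟩
      · obtain ⟨a, ha, rfl⟩ := hV i hi
        exact ⟨a, by simp [ha], rfl⟩

theorem IsTrailFrom.length_le_ncard [Finite E(L)] {v : α} {w : List (β × α)}
    (h : IsTrailFrom L v w) : w.length ≤ E(L).ncard := by
  classical
  have hE : ∀ {v w}, IsWalkFrom L v w → ∀ e ∈ w.map Prod.fst, e ∈ E(L) := by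
    intro v w h
    induction h with
    | nil => simp
    | cons h _ ih => simpa using ⟨h.edge_mem, by simpa using ih⟩
  rw [← List.length_map (f := Prod.fst), ← List.toFinset_card_of_nodup h.2,
    ← Set.ncard_coe_finset]
  exact Set.ncard_le_ncard (fun e he => hE h.1 e (by simpa using he)) (Set.toFinite _)

/-- Finiteness of `E(L)` bounds the lengths; on an unbounded set of naturals `sSup` would be `0`. -/
theorem IsTrailFrom.length_le [Finite E(L)] {v : α} {w : List (β × α)}
    (h : IsTrailFrom L v w) : w.length ≤ maxTrailLength L :=
  le_csSup ⟨E(L).ncard, by rintro _ ⟨v, w, h, rfl⟩; exact h.length_le_ncard⟩ ⟨v, w, h, rfl⟩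

theorem Attachment.exists_mem_ends_of_mem (A : Attachment L W D) (hx : x.2 ∈ D x.1) :
    ∃ e, x ∈ A.ends e :=
  (A.existsUnique x.1 x.2 hx).exists

theorem Attachment.exists_isLink (A : Attachment L W D) {e : E(L)} (hx : x ∈ A.ends e) :
    ∃ u, L.IsLink e x.1 u := by
  obtain ⟨y, hy⟩ := Sym2.mem_iff_exists.1 hx
  exact ⟨y.1, A.isLink e x y hy⟩

/-- A longest trail that spans `L` and begins with a given edge-end, in lifted form. -/
theorem IsAdmissible.exists_lift [Finite E(L)] (hadm : IsAdmissible L) (hx : x.2 ∈ D x.1) :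
    ∃ r z, A.IsLift x r z ∧ (edgeEnds x r z).Nodup ∧
      (∀ i : V(L), ∃ a ∈ edgeEnds x r z, a.1 = i) ∧
      (∀ a : Σ i, W i, a.2 ∈ D a.1 → a.1 = x.1 ∨ a.1 = z.1 → a ∈ edgeEnds x r z) ∧
      ∃ a : Σ i, W i, a.2 ∈ D a.1 ∧ a ∉ edgeEnds x r z := by
  classical
  obtain ⟨e, he⟩ := A.exists_mem_ends_of_mem hx
  obtain ⟨u₀, hl⟩ := A.exists_isLink he
  obtain ⟨u, w, hw, hlen, hspan⟩ := hadm.exists_trail x.1 e hl.inc_left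
  obtain ⟨r, z, hr, hnd, hE, hV, hext⟩ := hw.exists_lift w e.2 x rfl he
  refine ⟨r, z, hr, hnd, fun i => hV i (hspan i i.2), fun a ha hxz => ?_, ?_⟩
  -- An unused edge at the first vertex could be prepended, one at the last vertex appended.
  · by_contra hna
    obtain ⟨e', he'⟩ := A.exists_mem_ends_of_mem ha
    obtain ⟨u', hl'⟩ := A.exists_isLink he'
    rw [hE e' a he'] at hna
    rcases hxz with h | h
    · rw [h] at hl'
      have : IsTrailFrom L u' ((↑e', ↑x.1) :: (↑e, u) :: w) :=
        ⟨.cons hl'.symm hw.1, List.nodup_cons.2 ⟨hna, hw.2⟩⟩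
      have := this.length_le
      simp only [List.length_cons] at this hlen
      omega
    · rw [h] at hl'
      have : IsTrailFrom L x.1 (((↑e, u) :: w) ++ [((e' : β), u')]) := by
        refine ⟨hext _ _ hl', ?_⟩
        rw [List.map_append, List.nodup_append']
        exact ⟨hw.2, by simp, by simpa using hna⟩
      have := this.length_le
      rw [List.length_append] at this
      simp only [List.length_cons, List.length_nil] at this hlen
      omega
  · by_contra! hall
    refine absurd hadm.maxTrailLength_lt (not_lt.2 ?_)
    rw [← hlen, ← List.length_map (f := Prod.fst), ← List.toFinset_card_of_nodup hw.2,
      ← Set.ncard_coe_finset]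
    refine Set.ncard_le_ncard (fun e' he' => ?_) (Finset.finite_toSet _)
    obtain ⟨a, ha⟩ : ∃ a, a ∈ A.ends ⟨e', he'⟩ := ⟨_, Sym2.out_fst_mem _⟩
    have := (hE ⟨e', he'⟩ a ha).1 (hall a (A.mem_distinguished _ a ha))
    simpa using this

/-- If a lifted spanning trail uses all the edges at its first and at its last vertex, then these two
are different, and it passes exactly once through each vertex. -/
theorem Attachment.IsLift.visits (hG : ∀ i, IsIType (G i) (D i)) (hr : A.IsLift x r z)
    (hnd : (edgeEnds x r z).Nodup) (hspan : ∀ i : V(L), ∃ a ∈ edgeEnds x r z, a.1 = i)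
    (hends : ∀ a : Σ i, W i, a.2 ∈ D a.1 → a.1 = x.1 ∨ a.1 = z.1 → a ∈ edgeEnds x r z) :
    (r.map fun p => p.1.1).Nodup ∧ (∀ i, ∃ p ∈ r, p.1.1 = i) ∧ z.1 ≠ x.1 := by
  have hmem := hr.mem_distinguished
  have hfst := hr.fst_eq
  have hx : x ∈ edgeEnds x r z := mem_edgeEnds.2 (Or.inl rfl)
  have hz : z ∈ edgeEnds x r z := mem_edgeEnds.2 (Or.inr (Or.inr rfl))
  have h1 : ∀ p ∈ r, p.1 ∈ edgeEnds x r z :=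
    fun p hp => mem_edgeEnds.2 (Or.inr (Or.inl ⟨p, hp, Or.inl rfl⟩))
  have h2 : ∀ p ∈ r, p.2 ∈ edgeEnds x r z :=
    fun p hp => mem_edgeEnds.2 (Or.inr (Or.inl ⟨p, hp, Or.inr rfl⟩))
  have hnd' := hnd
  rw [edgeEnds, List.cons_append, List.nodup_cons, List.nodup_append', List.nodup_flatMap] at hnd'
  obtain ⟨hxn, ⟨hpair, hpw⟩, -, hzn⟩ := hnd'
  have hcover : ∀ i, ∃ p ∈ r, p.1.1 = i := by
    have key : ∀ i, i = x.1 ∨ i = z.1 → ∃ p ∈ r, p.1.1 = i := by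
      intro i hi
      by_contra! hno
      -- Of the three ends at `i`, one is neither `x` nor `z`; being used, it belongs to an inner
      -- visit.
      obtain ⟨d, hd, hdx, hdz⟩ : ∃ a : Σ i, W i, (a.1 = i ∧ a.2 ∈ D a.1) ∧ a ≠ x ∧ a ≠ z := by
        classical
        have : ({x, z} : Finset (Σ i, W i)).card <
            ((D i).map (Function.Embedding.sigmaMk i)).card := by
          rw [Finset.card_map, (hG i).card_eq]
          exact Finset.card_le_two.trans_lt (by norm_num)
        obtain ⟨c, hc, hn⟩ := Finset.exists_mem_notMem_of_card_lt_card this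
        obtain ⟨d, hd, rfl⟩ := Finset.mem_map.1 hc
        exact ⟨_, ⟨rfl, hd⟩, by simpa using hn⟩
      obtain ⟨rfl, hd⟩ := hd
      rcases mem_edgeEnds.1 (hends d hd hi) with h | ⟨p, hp, h | h⟩ | h
      · exact hdx h
      · exact hno p hp (h ▸ rfl)
      · exact hno p hp (h ▸ hfst p hp)
      · exact hdz h
    intro i
    obtain ⟨a, ha, rfl⟩ := hspan i
    rcases mem_edgeEnds.1 ha with rfl | ⟨p, hp, rfl | rfl⟩ | rfl
    · exact key _ (Or.inl rfl)
    · exact ⟨p, hp, rfl⟩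
    · exact ⟨p, hp, hfst p hp⟩
    · exact key _ (Or.inr rfl)
  refine ⟨?_, hcover, fun hzx => ?_⟩
  · rw [List.Nodup, List.pairwise_map]
    -- Two inner visits to one vertex would use four distinct ends there.
    refine hpw.imp_of_mem fun {p q} hp hq hpq heq => ?_
    have := length_le_three hG p.1.1 (l := [p.1, p.2] ++ [q.1, q.2])
      (List.nodup_append'.2 ⟨hpair p hp, hpair q hq, hpq⟩)
      (by
        simpa using ⟨hmem _ (h1 p hp), ⟨(hfst p hp).symm, hmem _ (h2 p hp)⟩,
          ⟨heq.symm, hmem _ (h1 q hq)⟩, ((hfst q hq).symm.trans heq.symm), hmem _ (h2 q hq)⟩)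
    simp at this
  -- If the trail were closed, `x`, `z` and the two ends of an inner visit would be four ends at one
  -- vertex.
  · obtain ⟨p, hp, hpx⟩ := hcover x.1
    have := length_le_three hG x.1 (l := x :: ([p.1, p.2] ++ [z]))
      (hnd.sublist <| by
        rw [edgeEnds, List.cons_append]
        refine List.Sublist.cons_cons _ (List.Sublist.append_right (l₁ := [p.1, p.2]) ?_ [z])
        rw [List.flatMap_def]
        exact List.sublist_flatten_of_mem
          (List.mem_map_of_mem (f := fun p : (Σ i, W i) × (Σ i, W i) => [p.1, p.2]) hp))
      (by
        simpa using ⟨hmem _ hx, ⟨hpx, hmem _ (h1 p hp)⟩,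
          ⟨(hfst p hp).symm.trans hpx, hmem _ (h2 p hp)⟩, hzx, hmem _ hz⟩)
    simp at this

end Lift

/-! ### Paths attaining the bound, and connectedness -/

section Main

variable {α β : Type*} {L : Graph α β} {W : V(L) → Type*} {D : ∀ i, Finset (W i)}
  {A : Attachment L W D} {G : ∀ i, SimpleGraph (W i)}

theorem IsAdmissible.nonempty (hadm : IsAdmissible L) : Nonempty V(L) := by
  obtain ⟨e, he⟩ : E(L).Nonempty := by
    rw [Set.nonempty_iff_ne_empty]
    intro h
    have := hadm.maxTrailLength_lt
    simp [h] at this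
  obtain ⟨x, y, h⟩ := L.exists_isLink_of_mem_edgeSet he
  exact ⟨⟨x, h.left_mem⟩⟩

/-- An end of an untraversed edge lies at a third vertex, besides the distinct first and last
vertices of the trail. -/
theorem two_lt_card [Fintype V(L)] [Finite E(L)] (hadm : IsAdmissible L)
    (hG : ∀ i, IsIType (G i) (D i)) (A : Attachment L W D) : 2 < Fintype.card V(L) := by
  obtain ⟨i⟩ := hadm.nonempty
  obtain ⟨d, hd⟩ := (hG i).exists_mem
  obtain ⟨r, z, hr, hnd, hspan, hends, a, ha, hna⟩ :=
    hadm.exists_lift (A := A) (x := ⟨i, d⟩) hd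
  obtain ⟨-, -, hne⟩ := hr.visits hG hnd hspan hends
  exact Fintype.two_lt_card_iff.2 ⟨i, z.1, a.1, hne.symm,
    fun h => hna (hends a ha (Or.inl h.symm)), fun h => hna (hends a ha (Or.inr h.symm))⟩

variable (A) in
theorem exists_walk_fiber {i : V(L)} {u v : W i} (q : (G i).Walk u v) :
    ∃ q' : (inflation G A).Walk ⟨i, u⟩ ⟨i, v⟩, q'.support = q.support.map (Sigma.mk i) :=
  ⟨q.map (fiberHom A G i), SimpleGraph.Walk.support_map _ _⟩

theorem length_add_length_eq_card {V : Type*} [Fintype V] {l l' : List V} (hl : l.Nodup)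
    (hl' : l'.Nodup) (hd : l.Disjoint l') (hs : ∀ x, x ∈ l ∨ x ∈ l') :
    l.length + l'.length = Fintype.card V := by
  classical
  rw [← List.length_append, ← List.toFinset_card_of_nodup (List.nodup_append'.2 ⟨hl, hl', hd⟩),
    ← Finset.card_univ]
  congr 1
  ext x
  simpa using hs x

theorem sum_map_eq_sum_univ {ι γ : Type*} [Fintype ι] {l : List γ} {f : γ → ι}
    (hnd : (l.map f).Nodup) (hcover : ∀ i, ∃ p ∈ l, f p = i) (g : ι → ℕ) :
    (l.map fun p => g (f p)).sum = ∑ i, g i := by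
  classical
  have h : (l.map f).toFinset = Finset.univ := by
    ext i
    simpa using hcover i
  rw [← h, List.sum_toFinset g hnd, List.map_map]
  rfl

theorem exists_long_path [Fintype V(L)] [Finite E(L)] [∀ i, Fintype (W i)]
    (hadm : IsAdmissible L) (hG : ∀ i, IsIType (G i) (D i)) (v : Σ i, W i) :
    ∃ (y : Σ i, W i) (p : (inflation G A).Walk v y), p.IsPath ∧
      p.support.length + Fintype.card V(L) = ∑ i, Fintype.card (W i) + 2 ∧
      ∀ i, ∃ w : W i, ⟨i, w⟩ ∈ p.support := by
  classical
  obtain ⟨i₀, v⟩ := v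
  obtain ⟨a, ha, P, hP, hQ⟩ := (hG i₀).exists_path_pair v
  obtain ⟨r, z, hr, hnd, hspan, hends, -⟩ := hadm.exists_lift (A := A) (x := ⟨i₀, a⟩) ha
  obtain ⟨hfib, hcover, hz⟩ := hr.visits hG hnd hspan hends
  -- The number added to `l.length` counts the vertices left out by the inner visit: those of `P` in
  -- copy `i₀`, one elsewhere. The premise `p ∈ r` sits under `∃ l` so that `choose` yields a
  -- function of `p` alone.
  have hseg : ∀ p : (Σ i, W i) × (Σ i, W i), ∃ l : List (Σ i, W i), p ∈ r →
      (∃ q : (inflation G A).Walk p.1 p.2, q.support = l) ∧ l.Nodup ∧ (∀ b ∈ l, b.1 = p.1.1) ∧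
      z ∉ l ∧ (P.support.map (Sigma.mk i₀)).Disjoint l ∧
      l.length + (if p.1.1 = i₀ then P.support.length else 1) = Fintype.card (W p.1.1) := by
    intro p
    by_cases hp : p ∈ r
    swap
    · exact ⟨[], fun h => absurd h hp⟩
    have hnd' := hnd
    rw [edgeEnds, List.cons_append, List.nodup_cons, List.nodup_append', List.nodup_flatMap]
      at hnd'
    obtain ⟨hxn, ⟨hpair, -⟩, -, hzn⟩ := hnd'
    have hne : p.1 ≠ p.2 := by simpa using hpair p hp
    have hx1 : (⟨i₀, a⟩ : Σ i, W i) ≠ p.1 := by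
      rintro h
      exact hxn (List.mem_append_left _ (List.mem_flatMap.2 ⟨p, hp, by simp [h]⟩))
    have hx2 : (⟨i₀, a⟩ : Σ i, W i) ≠ p.2 := by
      rintro h
      exact hxn (List.mem_append_left _ (List.mem_flatMap.2 ⟨p, hp, by simp [h]⟩))
    have hz1 : p.1 ≠ z := by
      rintro h
      exact hzn (a := p.1) (List.mem_flatMap.2 ⟨p, hp, by simp⟩) (by simp [h])
    have hz2 : p.2 ≠ z := by
      rintro h
      exact hzn (a := p.2) (List.mem_flatMap.2 ⟨p, hp, by simp⟩) (by simp [h])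
    have h1 := hr.mem_distinguished p.1 (mem_edgeEnds.2 (Or.inr (Or.inl ⟨p, hp, Or.inl rfl⟩)))
    have h2 := hr.mem_distinguished p.2 (mem_edgeEnds.2 (Or.inr (Or.inl ⟨p, hp, Or.inr rfl⟩)))
    have h3 := hr.mem_distinguished z (mem_edgeEnds.2 (Or.inr (Or.inr rfl)))
    have h12 := hr.fst_eq p hp
    obtain ⟨⟨i, b⟩, ⟨j, c⟩⟩ := p
    obtain rfl : i = j := h12
    simp only [ne_eq, Sigma.mk.injEq, heq_eq_eq, true_and] at hne
    by_cases hi : i = i₀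
    · subst hi
      simp only [ne_eq, Sigma.mk.injEq, heq_eq_eq, true_and] at hx1 hx2
      obtain ⟨q, hq, hd, hs⟩ := hQ b h1 c h2 hne hx1 hx2
      refine ⟨q.support.map (Sigma.mk i), fun _ => ⟨exists_walk_fiber A q,
        hq.support_nodup.map sigma_mk_injective, by simp, ?_, ?_, ?_⟩⟩
      · intro h
        obtain ⟨w, -, rfl⟩ := List.mem_map.1 h
        exact hz rfl
      · exact (List.disjoint_map sigma_mk_injective hd)
      · rw [if_pos rfl, List.length_map, add_comm]
        exact length_add_length_eq_card hP.support_nodup hq.support_nodup hd hs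
    · obtain ⟨d, hd, hdb, hdc⟩ := (hG i).exists_third b c
      -- In the last copy the omitted vertex has to be `z`, which is kept for the end of the path.
      obtain ⟨d, hd, hdb, hdc, hzd⟩ : ∃ d ∈ D i, d ≠ b ∧ d ≠ c ∧ (z.1 = i → z = ⟨i, d⟩) := by
        by_cases hzi : z.1 = i
        · obtain ⟨j, w⟩ := z
          obtain rfl : j = i := hzi
          simp only [ne_eq, Sigma.mk.injEq, heq_eq_eq, true_and] at hz1 hz2
          exact ⟨w, h3, Ne.symm hz1, Ne.symm hz2, fun _ => rfl⟩
        · exact ⟨d, hd, hdb, hdc, fun h => absurd h hzi⟩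
      obtain ⟨q, hq, hdq, hs⟩ := (hG i).exists_path_avoiding hd h1 h2 hne hdb hdc
      refine ⟨q.support.map (Sigma.mk i), fun _ => ⟨exists_walk_fiber A q,
        hq.support_nodup.map sigma_mk_injective, by simp, ?_, ?_, ?_⟩⟩
      · intro h
        obtain ⟨w, hw, rfl⟩ := List.mem_map.1 h
        obtain rfl := sigma_mk_injective (hzd rfl)
        exact hdq hw
      · intro x hx hx'
        obtain ⟨w, -, rfl⟩ := List.mem_map.1 hx
        obtain ⟨w', -, hw'⟩ := List.mem_map.1 hx'
        exact hi (congrArg Sigma.fst hw')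
      · rw [if_neg hi, List.length_map]
        exact length_add_length_eq_card (l' := [d]) hq.support_nodup (by simp) (by simpa using hdq)
          (fun x => by
            by_cases hx : x = d
            · simp [hx]
            · exact Or.inl (hs x hx))
  choose seg hseg using hseg
  obtain ⟨T, hT⟩ := hr.exists_walk seg fun p hp => (hseg p hp).1
  obtain ⟨R, hR⟩ := exists_walk_fiber A P
  have hsupp : (R.append T).support =
      P.support.map (Sigma.mk i₀) ++ (r.flatMap seg ++ [z]) := by
    rw [SimpleGraph.Walk.support_append, hT, hR]
    simp
  refine ⟨z, R.append T, SimpleGraph.Walk.IsPath.mk' ?_, ?_, fun i => ?_⟩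
  · rw [hsupp, List.nodup_append', List.nodup_append', List.nodup_flatMap]
    refine ⟨hP.support_nodup.map sigma_mk_injective,
      ⟨⟨fun p hp => (hseg p hp).2.1, ?_⟩, by simp, ?_⟩, ?_⟩
    · rw [List.Nodup, List.pairwise_map] at hfib
      refine hfib.imp_of_mem fun {p q} hp hq hpq b hb hb' => hpq ?_
      rw [← (hseg p hp).2.2.1 b hb, (hseg q hq).2.2.1 b hb']
    · intro b hb hb'
      obtain rfl := List.mem_singleton.1 hb'
      obtain ⟨p, hp, hbp⟩ := List.mem_flatMap.1 hb
      exact (hseg p hp).2.2.2.1 hbp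
    · rw [List.disjoint_append_right]
      refine ⟨fun b hb hb' => ?_, ?_⟩
      · obtain ⟨p, hp, hbp⟩ := List.mem_flatMap.1 hb'
        exact (hseg p hp).2.2.2.2.1 hb hbp
      · intro b hb hb'
        obtain rfl := List.mem_singleton.1 hb'
        obtain ⟨w, -, rfl⟩ := List.mem_map.1 hb
        exact hz rfl
  · rw [hsupp, List.length_append, List.length_append, List.length_map, List.length_flatMap]
    have hsum := sum_map_eq_sum_univ hfib hcover fun i => Fintype.card (W i)
    rw [← List.map_congr_left fun p hp => (hseg p hp).2.2.2.2.2, List.sum_map_add,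
      sum_map_eq_sum_univ hfib hcover (fun i => if i = i₀ then P.support.length else 1)]
      at hsum
    -- The vertices left out by inner visits number `|P| + k - 1`, written without subtraction;
    -- adding `P` and `z` back leaves `k - 2` missed.
    have hite : ∑ i : V(L), ((if i = i₀ then P.support.length else 1) + if i = i₀ then 1 else 0) =
        ∑ i : V(L), (1 + if i = i₀ then P.support.length else 0) :=
      Finset.sum_congr rfl fun i _ => by split_ifs <;> omega
    rw [Finset.sum_add_distrib, Finset.sum_add_distrib] at hite
    simp only [Finset.sum_ite_eq', Finset.mem_univ, if_true, Finset.sum_const, Finset.card_univ,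
      smul_eq_mul, mul_one] at hite
    simp only [List.length_singleton]
    omega
  · obtain ⟨p, hp, rfl⟩ := hcover i
    obtain ⟨q, hq⟩ := (hseg p hp).1
    refine ⟨p.1.2, ?_⟩
    rw [hsupp]
    refine List.mem_append_right _ (List.mem_append_left _ (List.mem_flatMap.2 ⟨p, hp, ?_⟩))
    rw [← hq]
    exact q.start_mem_support

/-- A long path from `x` meets every copy, and each copy is connected. -/
theorem inflation_connected [Fintype V(L)] [Finite E(L)] [∀ i, Fintype (W i)]
    (hadm : IsAdmissible L) (hG : ∀ i, IsIType (G i) (D i)) : (inflation G A).Connected := by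
  classical
  obtain ⟨i⟩ := hadm.nonempty
  have : Nonempty (Σ i, W i) := ⟨⟨i, (hG i).exists_mem.choose⟩⟩
  refine ⟨fun x y => ?_⟩
  obtain ⟨z, p, -, -, hp⟩ := exists_long_path (A := A) hadm hG x
  obtain ⟨w, hw⟩ := hp y.1
  exact (p.takeUntil _ hw).reachable.trans
    (((hG y.1).preconnected w y.2).map (fiberHom A G y.1))

end Main

end Detour

theorem mainTheorem5 {α β : Type*} (L : Graph α β) [Fintype V(L)] [Finite E(L)]
    (hcubic : Detour.IsCubic L) (hadm : Detour.IsAdmissible L)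
    (k : ℕ) (hk : Fintype.card V(L) = k)
    {W : V(L) → Type*} [∀ i, Fintype (W i)]
    (G : ∀ i, SimpleGraph (W i)) (D : ∀ i, Finset (W i))
    (hG : ∀ i, Detour.IsIType (G i) (D i))
    (A : Detour.Attachment L W D) :
    Detour.NoMultipleEdges G A ∧
    Detour.IsCND (Detour.inflation G A) ∧
    (Detour.detourOrder (Detour.inflation G A) : ℤ) =
      2 - (k : ℤ) + ∑ i : V(L), (Fintype.card (W i) : ℤ) := by
  classical
  have hk2 := Detour.two_lt_card hadm hG A
  have hconn := Detour.inflation_connected (A := A) hadm hG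
  have hub {x y} {p : (Detour.inflation G A).Walk x y} (hp : p.IsPath) :=
    Detour.length_support_add_card_le hG hp
  have hlb (v) := Detour.exists_long_path (A := A) hadm hG v
  have hvert : ∀ v, Detour.vertexDetourOrder (Detour.inflation G A) v + Fintype.card V(L) =
      ∑ i, Fintype.card (W i) + 2 := fun v => by
    obtain ⟨y, p, hp, hlen, -⟩ := hlb v
    have hgr : IsGreatest {n | ∃ (u : _) (q : (Detour.inflation G A).Walk v u),
        q.IsPath ∧ q.support.length = n} p.support.length := by
      refine ⟨⟨y, p, hp, rfl⟩, ?_⟩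
      rintro _ ⟨u, q, hq, rfl⟩
      have := hub hq
      omega
    rw [Detour.vertexDetourOrder, hgr.csSup_eq, hlen]
  have hdet : Detour.detourOrder (Detour.inflation G A) + Fintype.card V(L) =
      ∑ i, Fintype.card (W i) + 2 := by
    obtain ⟨v⟩ := hconn.nonempty
    obtain ⟨y, p, hp, hlen, -⟩ := hlb v
    have hgr : IsGreatest {n | ∃ (v u : _) (q : (Detour.inflation G A).Walk v u),
        q.IsPath ∧ q.support.length = n} p.support.length := by
      refine ⟨⟨v, y, p, hp, rfl⟩, ?_⟩
      rintro _ ⟨v', u, q, hq, rfl⟩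
      have := hub hq
      omega
    rw [Detour.detourOrder, hgr.csSup_eq, hlen]
  refine ⟨Detour.noMultipleEdges hG, ⟨hconn, ?_, fun u v => ?_⟩, ?_⟩
  -- A hamiltonian path would have `∑ |W i|` vertices, exceeding the upper bound as `k > 2`.
  · rintro ⟨u, v, p, hp, hs⟩
    have hcard : Fintype.card (Σ i, W i) = p.support.length := by
      rw [← List.toFinset_card_of_nodup hp.support_nodup, ← Finset.card_univ]
      congr 1
      ext x
      simpa using hs x
    rw [Fintype.card_sigma] at hcard
    have := hub hp
    omega
  · have := hvert u
    have := hvert v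
    omega
  · rw [← hk]
    zify at hdet
    linarith
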